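/- **Setting.** Let $N,\hat N\ge 0$ be integers, $\sigma\ge 0$, $a\in\mathbb R$, $a_1,\dots,a_N>0$, $\hat a_1,\dots,\hat a_{\hat N}>0$, $0<\rho_1<\dots<\rho_N$ and $0<\hat\rho_1<\dots<\hat\rho_{\hat N}$. Let $X=(X_t)_{t\ge 0}$ be a hyperexponential Lévy process with these parameters, i.e. a real Lévy process with $X_0=0$ almost surely and $$\mathbb E\big[e^{i\theta X_t}\big]=\exp\Big(t\Big(ia\theta-\tfrac{\sigma^2\theta^2}{2}+\int_{\mathbb R}(e^{i\theta x}-1)\,\nu(dx)\Big)\Big),\qquad t\ge 0,\ \theta\in\mathbb R,$$ where $$\nu(dx)=\mathbb I(x<0)\sum_{\ell=1}^{\hat N}\hat a_\ell\hat\rho_\ell e^{\hat\rho_\ell x}\,dx+\mathbb I(x>0)\sum_{\ell=1}^{N}a_\ell\rho_\ell e^{-\rho_\ell x}\,dx .$$ Its Laplace exponent is, as a rational function, $$\psi(z)=\frac{\sigma^2z^2}{2}+az+z\sum_{\ell=1}^{N}\frac{a_\ell}{\rho_\ell-z}-z\sum_{\ell=1}^{\hat N}\frac{\hat a_\ell}{\hat\rho_\ell+z}.$$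 Let $q>0$ and let $\mathbf e(q)$ be an exponential random variable with mean $q^{-1}$, independent of $X$. Put $M=N+1$ if $\sigma\ne 0$ or $a>0$, and $M=N$ otherwise; put $\hat M=\hat N+1$ if $\sigma\ne 0$ or $a<0$, and $\hat M=\hat N$ otherwise. **Theorem 3.1.** The equation $\psi(z)=q$ has exactly $M$ positive solutions $\zeta_1<\dots<\zeta_M$ and exactly $\hat M$ negative solutions $-\hat\zeta_1>\dots>-\hat\zeta_{\hat M}$. They satisfy $\psi'(\zeta_\ell)>0$ and $\psi'(-\hat\zeta_\ell)<0$, and $X_{\mathbf e(q)}$ has the distribution $$\mathbb P\big(X_{\mathbf e(q)}\in dx\big)=q\alpha\,\delta_0(dx)+q\left(\mathbb I(x>0)\sum_{\ell=1}^{M}\frac{e^{-\zeta_\ell x}}{\psi'(\zeta_\ell)}-\mathbb I(x<0)\sum_{\ell=1}^{\hat M}\frac{e^{\hat\zeta_\ell x}}{\psi'(-\hat\zeta_\ell)}\right)dx,$$ where $\alpha=\gamma:=\big(q+\sum_{\ell=1}^{N}a_\ell+\sum_{\ell=1}^{\hat N}\hat a_\ell\big)^{-1}$ if $\sigma^2$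 and $a$ are both zero, and $\alpha=0$ otherwise. -/

import Mathlib

open MeasureTheory ProbabilityTheory Filter Topology
open scoped NNReal ENNReal

noncomputable section

/-- `X` is a (one-dimensional, real-valued) Lévy process on the probability space `(Ω, P)`: it starts
at `0` almost surely, has independent and stationary increments, and has almost surely
right-continuous paths with left limits. -/
structure IsLevyProcess {Ω : Type*} [MeasurableSpace Ω] (P : Measure Ω) (X : ℝ≥0 → Ω → ℝ) :
    Prop where
  measurable : ∀ t, Measurable (X t)
  zero : ∀ᵐ ω ∂P, X 0 ω = 0
  indep : HasIndepIncrements X P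
  stationary : ∀ s h : ℝ≥0, IdentDistrib (fun ω => X (s + h) ω - X s ω) (X h) P P
  cadlag : ∀ᵐ ω ∂P, ∀ t : ℝ≥0,
    ContinuousWithinAt (fun s => X s ω) (Set.Ici t) t ∧
      ∃ l : ℝ, Tendsto (fun s => X s ω) (𝓝[<] t) (𝓝 l)

/-- Parameters of a hyperexponential Lévy process: the Gaussian coefficient `σ ≥ 0`, the drift, the
`N` weights and rates `a, ρ` of the positive jumps and the `N'` weights and rates `aHat, ρHat` of
the negative jumps. Either of `N`, `N'` may be zero. -/
structure HyperexpParams (N N' : ℕ) where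
  σ : ℝ
  drift : ℝ
  a : Fin N → ℝ
  ρ : Fin N → ℝ
  aHat : Fin N' → ℝ
  ρHat : Fin N' → ℝ
  σ_nonneg : 0 ≤ σ
  a_pos : ∀ l, 0 < a l
  ρ_pos : ∀ l, 0 < ρ l
  ρ_strictMono : StrictMono ρ
  aHat_pos : ∀ l, 0 < aHat l
  ρHat_pos : ∀ l, 0 < ρHat l
  ρHat_strictMono : StrictMono ρHat

namespace HyperexpParams

variable {N N' : ℕ} (p : HyperexpParams N N')

/-- The Lévy density
`𝟙(x < 0) ∑ aHat_l ρHat_l e^{ρHat_l x} + 𝟙(x > 0) ∑ a_l ρ_l e^{-ρ_l x}`. -/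
def levyDensity (x : ℝ) : ℝ :=
  (if x < 0 then ∑ l, p.aHat l * p.ρHat l * Real.exp (p.ρHat l * x) else 0) +
    (if 0 < x then ∑ l, p.a l * p.ρ l * Real.exp (-(p.ρ l) * x) else 0)

/-- The (finite) Lévy measure `ν`. -/
def levyMeasure : Measure ℝ :=
  volume.withDensity fun x => ENNReal.ofReal (p.levyDensity x)

/-- The Lévy–Khintchine exponent `θ ↦ i a θ - σ² θ² / 2 + ∫ (e^{iθx} - 1) ν(dx)` of the process with
drift `a`, Gaussian coefficient `σ` and Lévy measure `ν`. As `ν` is finite, no truncation function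
is needed. -/
def levyKhintchine (θ : ℝ) : ℂ :=
  Complex.I * p.drift * θ - (p.σ : ℂ) ^ 2 * (θ : ℂ) ^ 2 / 2 +
    ∫ x : ℝ, (Complex.exp (Complex.I * θ * x) - 1) ∂p.levyMeasure

/-- The Laplace exponent, extended to the real line as the rational function
`ψ(z) = σ² z² / 2 + a z + z ∑ a_l / (ρ_l - z) - z ∑ aHat_l / (ρHat_l + z)`.
It has poles at the points `ρ_l` and `-ρHat_l`, where the value of this Lean function carries no
meaning. -/
def psi (z : ℝ) : ℝ :=
  p.σ ^ 2 * z ^ 2 / 2 + p.drift * z + z * ∑ l, p.a l / (p.ρ l - z) -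
    z * ∑ l, p.aHat l / (p.ρHat l + z)

/-- The real solutions of `ψ(z) = q` (the poles of `ψ` are not solutions). -/
def solutions (q : ℝ) : Set ℝ :=
  {z | (∀ l, z ≠ p.ρ l) ∧ (∀ l, z ≠ -p.ρHat l) ∧ p.psi z = q}

open Classical in
/-- The number `M` of positive solutions of `ψ(z) = q`: it is `N + 1` if `σ ≠ 0` or `a > 0`, and `N`
otherwise. -/
def numPos : ℕ := if p.σ ≠ 0 ∨ 0 < p.drift then N + 1 else N

open Classical in
/-- The number of negative solutions of `ψ(z) = q`: it is `N' + 1` if `σ ≠ 0` or `a < 0`, and `N'`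
otherwise. -/
def numNeg : ℕ := if p.σ ≠ 0 ∨ p.drift < 0 then N' + 1 else N'

/-- `γ = 1 / (q + ∑ a_l + ∑ aHat_l)`. -/
def gam (q : ℝ) : ℝ := 1 / (q + ∑ l, p.a l + ∑ l, p.aHat l)

open Classical in
/-- `α = γ` if `σ² = 0` and `a = 0`, and `α = 0` otherwise. -/
def alpha (q : ℝ) : ℝ := if p.σ ^ 2 = 0 ∧ p.drift = 0 then p.gam q else 0

/-- The density of the absolutely continuous part, built from numbers `ζ_l` and `ζHat_l`:
`q (𝟙(x > 0) ∑ e^{-ζ_l x} / ψ'(ζ_l) - 𝟙(x < 0) ∑ e^{ζHat_l x} / ψ'(-ζHat_l))`. -/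
def killedDensity {M M' : ℕ} (q : ℝ) (ζ : Fin M → ℝ) (ζHat : Fin M' → ℝ) (x : ℝ) : ℝ :=
  q * ((if 0 < x then ∑ l, Real.exp (-(ζ l) * x) / deriv p.psi (ζ l) else 0) -
    (if x < 0 then ∑ l, Real.exp (ζHat l * x) / deriv p.psi (-(ζHat l)) else 0))

end HyperexpParams

/-- `X` is a hyperexponential Lévy process with parameters `p`: a Lévy process whose
Lévy–Khintchine triplet is given by the drift, the Gaussian coefficient and the Lévy measure of `p`,
that is `E[e^{iθX_t}] = e^{t (i a θ - σ² θ² / 2 + ∫ (e^{iθx} - 1) ν(dx))}`. -/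
structure IsHyperexponential {Ω : Type*} [MeasurableSpace Ω] (P : Measure Ω) (X : ℝ≥0 → Ω → ℝ)
    {N N' : ℕ} (p : HyperexpParams N N') : Prop extends IsLevyProcess P X where
  charFun_eq : ∀ (t : ℝ≥0) (θ : ℝ),
    charFun (P.map (X t)) θ = Complex.exp ((t : ℝ) * p.levyKhintchine θ)

end

/-! Division by `z` makes the equation monotone: `(ψ(z) - q) / z` has the form `s z + b - ∑ c_k / (z
- x_k)` with `s = σ² / 2`, `b` the drift, and simple poles at `0`, `ρ_l` and `-ρHat_l`. All weights
are positive; the one at `0` is `q`. Such a function increases from `-∞` to `+∞` between consecutive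
poles, so each gap contains exactly one zero. Beyond the last pole it increases from `-∞` to `+∞` if
`σ ≠ 0` and to the drift if `σ = 0`, which decides whether there is one more zero
(`existsUnique_pickFun_zero_Ioo`, `existsUnique_pickFun_zero_Ioi`, `pickFun_neg_of_gt`). At a zero,
`ψ'` is `z` times a positive number, hence the signs in `exists_hasDerivAt_psi`. Negative solutions
come from the process `-X`.

The law is identified by its characteristic function. With `Ψ(θ) = ψ(iθ)`, averaging `e^{tΨ}` over
the independent exponential time gives `q / (q - Ψ)` (`charFun_map_process_randomTime`,
`integral_cexp_expMeasure`). The real zeros found above are as many as the degree of the numerator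
of `ψ - q` allows, and they are simple, so `1 / (ψ - q) = -α + ∑ 1 / (ψ'(r) (z - r))` over these
zeros `r` (`inv_rational_eq_sum`). The constant survives only when numerator and denominator have
equal degree, that is when `σ` and the drift vanish. Up to the factor `-q`, the constant is the
transform of an atom at `0`, and each fraction that of an exponential density on a half-line. -/

/-! ### Zeros of rational functions that increase between their poles -/

/-- The rational function `z ↦ s z + b - ∑ c_k / (z - x_k)`. For `s ≥ 0` and `c_k > 0` it increases
between consecutive poles. -/
noncomputable def pickFun {K : Type*} [Fintype K] (s b : ℝ) (c x : K → ℝ) (z : ℝ) : ℝ :=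
  s * z + b - ∑ k, c k / (z - x k)

section PickFun

variable {K : Type*} [Fintype K] {s b : ℝ} {c x : K → ℝ}

theorem hasDerivAt_pickFun {z : ℝ} (hz : ∀ k, z ≠ x k) :
    HasDerivAt (pickFun s b c x) (s + ∑ k, c k / (z - x k) ^ 2) z := by
  have h1 : ∀ k ∈ Finset.univ, HasDerivAt (fun z => c k / (z - x k)) (-(c k / (z - x k) ^ 2)) z := by
    intro k _
    have h := (hasDerivAt_const z (c k)).div ((hasDerivAt_id z).sub_const (x k))
      (sub_ne_zero.2 (hz k))
    refine h.congr_deriv ?_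
    simp [neg_div]
  have h2 := (((hasDerivAt_id z).const_mul s).add_const b).sub (HasDerivAt.fun_sum h1)
  refine h2.congr_deriv ?_
  simp

theorem continuousOn_pickFun {S : Set ℝ} (hS : ∀ z ∈ S, ∀ k, z ≠ x k) :
    ContinuousOn (pickFun s b c x) S :=
  fun z hz => (hasDerivAt_pickFun (hS z hz)).continuousAt.continuousWithinAt

theorem pickFun_deriv_pos [Nonempty K] (hs : 0 ≤ s) (hc : ∀ k, 0 < c k) {z : ℝ}
    (hz : ∀ k, z ≠ x k) : 0 < s + ∑ k, c k / (z - x k) ^ 2 := by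
  refine add_pos_of_nonneg_of_pos hs (Finset.sum_pos (fun k _ => ?_) Finset.univ_nonempty)
  have := sub_ne_zero.2 (hz k)
  have := hc k
  positivity

theorem strictMonoOn_pickFun [Nonempty K] (hs : 0 ≤ s) (hc : ∀ k, 0 < c k) {S : Set ℝ}
    (hconv : Convex ℝ S) (hS : ∀ z ∈ S, ∀ k, z ≠ x k) : StrictMonoOn (pickFun s b c x) S := by
  refine strictMonoOn_of_deriv_pos hconv (continuousOn_pickFun hS) fun z hz => ?_
  have hz' := hS z (interior_subset hz)
  rw [(hasDerivAt_pickFun hz').deriv]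
  exact pickFun_deriv_pos hs hc hz'

/-- Isolates the singular term at one pole. The remainder is continuous there when the poles are
distinct, so the one-sided limits are those of `-c / (z - x)`. -/
theorem pickFun_eq_add_pole [DecidableEq K] (k : K) (z : ℝ) :
    pickFun s b c x z =
      -(c k / (z - x k)) + (s * z + b - ∑ j ∈ Finset.univ.erase k, c j / (z - x j)) := by
  rw [pickFun, ← Finset.add_sum_erase _ _ (Finset.mem_univ k)]
  ring

theorem continuousAt_pickFun_regular_part [DecidableEq K] (hx : Function.Injective x) (k : K) :
    ContinuousAt
      (fun z => s * z + b - ∑ j ∈ Finset.univ.erase k, c j / (z - x j)) (x k) := by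
  refine ContinuousAt.sub (by fun_prop) ?_
  refine tendsto_finsetSum _ fun j hj => ?_
  have : x k - x j ≠ 0 := sub_ne_zero.2 fun h => (Finset.ne_of_mem_erase hj) (hx h).symm
  exact ContinuousAt.div (by fun_prop) (by fun_prop) this

theorem tendsto_pickFun_right (hc : ∀ k, 0 < c k) (hx : Function.Injective x) (k : K) :
    Tendsto (pickFun s b c x) (𝓝[>] x k) atBot := by
  classical
  have h1 : Tendsto (fun z => -(c k / (z - x k))) (𝓝[>] x k) atBot := by
    refine tendsto_neg_atTop_atBot.comp ?_
    simp only [div_eq_mul_inv]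
    refine Tendsto.const_mul_atTop (hc k) (tendsto_inv_nhdsGT_zero.comp ?_)
    refine tendsto_nhdsWithin_iff.2 ⟨?_, ?_⟩
    · have : ContinuousAt (fun z => z - x k) (x k) := by fun_prop
      simpa using this.tendsto.mono_left nhdsWithin_le_nhds
    · filter_upwards [self_mem_nhdsWithin] with z hz using sub_pos.2 (Set.mem_Ioi.1 hz)
  have h := h1.atBot_add
    ((continuousAt_pickFun_regular_part (s := s) (b := b) (c := c) hx k).tendsto.mono_left
      (nhdsWithin_le_nhds (s := Set.Ioi (x k))))
  exact h.congr fun z => (pickFun_eq_add_pole k z).symm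

theorem tendsto_pickFun_left (hc : ∀ k, 0 < c k) (hx : Function.Injective x) (k : K) :
    Tendsto (pickFun s b c x) (𝓝[<] x k) atTop := by
  classical
  have h1 : Tendsto (fun z => -(c k / (z - x k))) (𝓝[<] x k) atTop := by
    refine tendsto_neg_atBot_atTop.comp ?_
    simp only [div_eq_mul_inv]
    refine Tendsto.const_mul_atBot (hc k) (tendsto_inv_nhdsLT_zero.comp ?_)
    refine tendsto_nhdsWithin_iff.2 ⟨?_, ?_⟩
    · have : ContinuousAt (fun z => z - x k) (x k) := by fun_prop
      simpa using this.tendsto.mono_left nhdsWithin_le_nhds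
    · filter_upwards [self_mem_nhdsWithin] with z hz using sub_neg.2 (Set.mem_Iio.1 hz)
  have h := h1.atTop_add
    ((continuousAt_pickFun_regular_part (s := s) (b := b) (c := c) hx k).tendsto.mono_left
      (nhdsWithin_le_nhds (s := Set.Iio (x k))))
  exact h.congr fun z => (pickFun_eq_add_pole k z).symm

/-- Strict monotonicity gives uniqueness; the limits `-∞` at the left end and `+∞` at the right end
give existence. -/
theorem existsUnique_pickFun_zero_Ioo (hs : 0 ≤ s) (hc : ∀ k, 0 < c k)
    (hx : Function.Injective x) {i j : K} (hij : x i < x j)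
    (hgap : ∀ k, x k ≤ x i ∨ x j ≤ x k) :
    ∃! z, z ∈ Set.Ioo (x i) (x j) ∧ pickFun s b c x z = 0 := by
  have : Nonempty K := ⟨i⟩
  have hS : ∀ z ∈ Set.Ioo (x i) (x j), ∀ k, z ≠ x k := by
    rintro z ⟨h1, h2⟩ k rfl
    rcases hgap k with h | h <;> linarith
  have hmono := strictMonoOn_pickFun (b := b) hs hc (convex_Ioo (x i) (x j)) hS
  have : (0 : ℝ) ∈ pickFun s b c x '' Set.Ioo (x i) (x j) := by
    refine isPreconnected_Ioo.intermediate_value_Iii (l₁ := 𝓝[>] x i) (l₂ := 𝓝[<] x j) ?_ ?_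
      (continuousOn_pickFun hS) (tendsto_pickFun_right hc hx i) (tendsto_pickFun_left hc hx j)
      (Set.mem_univ _)
    · exact le_principal_iff.2 (Ioo_mem_nhdsGT hij)
    · exact le_principal_iff.2 (Ioo_mem_nhdsLT hij)
  obtain ⟨z, hz, hz0⟩ := this
  exact ⟨z, ⟨hz, hz0⟩, fun y hy => hmono.injOn hy.1 hz (hy.2.trans hz0.symm)⟩

theorem tendsto_pickFun_sum_atTop : Tendsto (fun z => ∑ k, c k / (z - x k)) atTop (𝓝 0) := by
  rw [show (0 : ℝ) = ∑ _k : K, 0 by simp]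
  refine tendsto_finsetSum _ fun k _ => ?_
  exact tendsto_const_nhds.div_atTop (tendsto_atTop_add_const_right _ (-x k) tendsto_id)

/-- The function climbs from `-∞`. Its limit at infinity is `+∞` if `s > 0` and `b` if `s = 0`; in
both cases it is positive. -/
theorem existsUnique_pickFun_zero_Ioi (hs : 0 ≤ s) (hsb : s ≠ 0 ∨ 0 < b) (hc : ∀ k, 0 < c k)
    (hx : Function.Injective x) {i : K} (hi : ∀ k, x k ≤ x i) :
    ∃! z, z ∈ Set.Ioi (x i) ∧ pickFun s b c x z = 0 := by
  have : Nonempty K := ⟨i⟩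
  have hS : ∀ z ∈ Set.Ioi (x i), ∀ k, z ≠ x k := by
    rintro z hz k rfl
    exact absurd (hi k) (not_le.2 hz)
  have hmono := strictMonoOn_pickFun (b := b) hs hc (convex_Ioi (x i)) hS
  have : (0 : ℝ) ∈ pickFun s b c x '' Set.Ioi (x i) := by
    have hl₁ : 𝓝[>] x i ≤ 𝓟 (Set.Ioi (x i)) := inf_le_right
    have hl₂ : atTop ≤ 𝓟 (Set.Ioi (x i)) := le_principal_iff.2 (Ioi_mem_atTop _)
    rcases hs.eq_or_lt with h0 | hs
    · have hb : 0 < b := by simpa [← h0] using hsb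
      refine isPreconnected_Ioi.intermediate_value_Iio hl₁ hl₂ (continuousOn_pickFun hS)
        (tendsto_pickFun_right hc hx i) (v := b) ?_ hb
      have := (tendsto_const_nhds (x := b)).sub (tendsto_pickFun_sum_atTop (c := c) (x := x))
      rw [sub_zero] at this
      refine this.congr fun z => ?_
      simp [pickFun, ← h0]
    · refine isPreconnected_Ioi.intermediate_value_Iii hl₁ hl₂ (continuousOn_pickFun hS)
        (tendsto_pickFun_right hc hx i) ?_ (Set.mem_univ _)
      have h1 : Tendsto (fun z => s * z + b) atTop atTop :=
        tendsto_atTop_add_const_right _ _ (tendsto_id.const_mul_atTop hs)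
      have := h1.atTop_add (tendsto_pickFun_sum_atTop (c := c) (x := x)).neg
      refine this.congr fun z => ?_
      rw [pickFun, sub_eq_add_neg]
  obtain ⟨z, hz, hz0⟩ := this
  exact ⟨z, ⟨hz, hz0⟩, fun y hy => hmono.injOn hy.1 hz (hy.2.trans hz0.symm)⟩

theorem pickFun_neg_of_gt (hs : s = 0) (hb : b ≤ 0) (hc : ∀ k, 0 < c k) {i : K}
    (hi : ∀ k, x k ≤ x i) {z : ℝ} (hz : x i < z) : pickFun s b c x z < 0 := by
  have : 0 < ∑ k, c k / (z - x k) :=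
    Finset.sum_pos (fun k _ => div_pos (hc k) (by linarith [hi k])) ⟨i, Finset.mem_univ i⟩
  simp only [pickFun, hs]
  linarith

end PickFun

/-! ### Solutions of ψ(z) = q -/

namespace HyperexpParams

variable {N N' : ℕ} (p : HyperexpParams N N')

/-- The poles of `z ↦ (ψ(z) - q) / z`. -/
noncomputable def pole : Fin (N + 1) ⊕ Fin N' → ℝ :=
  Sum.elim (Fin.cons 0 p.ρ) fun l => -p.ρHat l

/-- The weights of the poles of `z ↦ (ψ(z) - q) / z`. -/
noncomputable def poleWeight (q : ℝ) : Fin (N + 1) ⊕ Fin N' → ℝ :=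
  Sum.elim (Fin.cons q p.a) p.aHat

/-- The function `z ↦ (ψ(z) - q) / z`. -/
noncomputable def quotFun (q : ℝ) : ℝ → ℝ :=
  pickFun (p.σ ^ 2 / 2) p.drift (p.poleWeight q) p.pole

theorem strictMono_cons_ρ : StrictMono (Fin.cons 0 p.ρ : Fin (N + 1) → ℝ) := by
  intro i j hij
  induction j using Fin.cases with
  | zero => exact absurd hij (Fin.not_lt_zero i)
  | succ j =>
    induction i using Fin.cases with
    | zero => simpa using p.ρ_pos j
    | succ i => simpa using p.ρ_strictMono (Fin.succ_lt_succ_iff.1 hij)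

theorem cons_ρ_nonneg (i : Fin (N + 1)) : 0 ≤ (Fin.cons 0 p.ρ : Fin (N + 1) → ℝ) i := by
  induction i using Fin.cases with
  | zero => simp
  | succ i => simpa using (p.ρ_pos i).le

theorem pole_injective : Function.Injective p.pole := by
  refine Function.Injective.sumElim p.strictMono_cons_ρ.injective
    (neg_injective.comp p.ρHat_strictMono.injective) fun i j h => ?_
  linarith [p.cons_ρ_nonneg i, p.ρHat_pos j]

theorem poleWeight_pos {q : ℝ} (hq : 0 < q) (k) : 0 < p.poleWeight q k := by
  rcases k with i | j
  · induction i using Fin.cases with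
    | zero => simpa [poleWeight] using hq
    | succ i => simpa [poleWeight] using p.a_pos i
  · simpa [poleWeight] using p.aHat_pos j

theorem ne_pole_iff {z : ℝ} :
    (∀ k, z ≠ p.pole k) ↔ z ≠ 0 ∧ (∀ l, z ≠ p.ρ l) ∧ ∀ l, z ≠ -p.ρHat l := by
  simp [pole, Fin.forall_fin_succ, and_assoc]

/-- The constant `q` becomes a pole at `0` with weight `q`. Each factor `z` in front of the sums of
`ψ` cancels, leaving positive weights on both families of poles. -/
theorem psi_eq_mul_quotFun (q : ℝ) {z : ℝ} (hz : z ≠ 0) : p.psi z = q + z * p.quotFun q z := by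
  have h1 : ∀ l, p.a l / (p.ρ l - z) = -(p.a l / (z - p.ρ l)) := fun l => by
    rw [← div_neg, neg_sub]
  have h2 : ∀ l, p.aHat l / (p.ρHat l + z) = p.aHat l / (z + p.ρHat l) := fun l => by
    rw [add_comm]
  simp only [psi, quotFun, pickFun, pole, poleWeight, Fintype.sum_sum_type, Sum.elim_inl,
    Sum.elim_inr, Fin.sum_univ_succ, Fin.cons_zero, Fin.cons_succ, h1, h2, sub_zero,
    Finset.sum_neg_distrib, sub_neg_eq_add]
  field_simp
  ring

theorem mem_solutions_iff {q z : ℝ} (hz : z ≠ 0) :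
    z ∈ p.solutions q ↔ (∀ k, z ≠ p.pole k) ∧ p.quotFun q z = 0 := by
  rw [ne_pole_iff, solutions, Set.mem_ofPred_eq, p.psi_eq_mul_quotFun q hz]
  simp [hz, and_assoc]

/-- In `ψ = q + z Q(z)` the product rule gives `ψ' = Q + z Q'`, and `Q` vanishes at a solution while
`Q' > 0`. -/
theorem exists_hasDerivAt_psi {q : ℝ} (hq : 0 < q) {z : ℝ} (hz : z ≠ 0)
    (h : z ∈ p.solutions q) : ∃ d, 0 < d ∧ HasDerivAt p.psi (z * d) z := by
  obtain ⟨h1, h2⟩ := (p.mem_solutions_iff hz).1 h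
  refine ⟨_, pickFun_deriv_pos (by positivity : (0 : ℝ) ≤ p.σ ^ 2 / 2) (p.poleWeight_pos hq) h1, ?_⟩
  have h3 := ((hasDerivAt_id z).mul
    (hasDerivAt_pickFun (s := p.σ ^ 2 / 2) (b := p.drift) (c := p.poleWeight q) h1)).const_add q
  refine HasDerivAt.congr_of_eventuallyEq (f := fun z => q + z * p.quotFun q z) ?_ ?_
  · refine h3.congr_deriv ?_
    rw [quotFun] at h2
    simp [h2]
  · filter_upwards [isOpen_ne.mem_nhds hz] with y hy using p.psi_eq_mul_quotFun q hy

theorem mem_solutions_pos_iff {q z : ℝ} :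
    (0 < z ∧ z ∈ p.solutions q) ↔ 0 < z ∧ (∀ l, z ≠ p.ρ l) ∧ p.quotFun q z = 0 := by
  refine and_congr_right fun hz => ?_
  rw [p.mem_solutions_iff hz.ne', ne_pole_iff]
  have : ∀ l, z ≠ -p.ρHat l := fun l h => by linarith [p.ρHat_pos l]
  simp [this, hz.ne']

theorem pole_inl_gap (i : Fin N) (k) :
    p.pole k ≤ p.pole (.inl i.castSucc) ∨ p.pole (.inl i.succ) ≤ p.pole k := by
  rcases k with k | k
  · simp only [pole, Sum.elim_inl, p.strictMono_cons_ρ.le_iff_le]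
    exact (le_or_gt k i.castSucc).imp_right Fin.castSucc_lt_iff_succ_le.1
  · left
    simp only [pole, Sum.elim_inl, Sum.elim_inr]
    linarith [p.cons_ρ_nonneg i.castSucc, p.ρHat_pos k]

theorem pole_le_last (k) : p.pole k ≤ p.pole (.inl (Fin.last N)) := by
  rcases k with k | k
  · simp only [pole, Sum.elim_inl, p.strictMono_cons_ρ.le_iff_le]
    exact Fin.le_last k
  · simp only [pole, Sum.elim_inl, Sum.elim_inr]
    linarith [p.cons_ρ_nonneg (Fin.last N), p.ρHat_pos k]

theorem pole_inl_lt (i : Fin N) : p.pole (.inl i.castSucc) < p.pole (.inl i.succ) := by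
  simpa only [pole, Sum.elim_inl] using p.strictMono_cons_ρ i.castSucc_lt_succ

theorem pole_inl_nonneg (i) : 0 ≤ p.pole (.inl i) := by
  simpa only [pole, Sum.elim_inl] using p.cons_ρ_nonneg i

/-- Induction along the increasing nonnegative poles `0, ρ_1, …, ρ_N`: `z` either passes the next
pole or is caught in the gap before it. -/
theorem exists_gap {z : ℝ} (hz : 0 < z) (hne : ∀ l, z ≠ p.ρ l) :
    (∃ i : Fin N, z ∈ Set.Ioo (p.pole (.inl i.castSucc)) (p.pole (.inl i.succ))) ∨
      p.pole (.inl (Fin.last N)) < z := by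
  have key : ∀ j : Fin (N + 1), p.pole (.inl j) < z ∨
      ∃ i : Fin N, z ∈ Set.Ioo (p.pole (.inl i.castSucc)) (p.pole (.inl i.succ)) := by
    intro j
    induction j using Fin.induction with
    | zero => left; simpa [pole] using hz
    | succ i ih =>
      rcases ih with ih | ih
      · rcases lt_trichotomy z (p.pole (.inl i.succ)) with h | h | h
        · exact Or.inr ⟨i, ih, h⟩
        · exact absurd (by simpa [pole] using h) (hne i)
        · exact Or.inl h
      · exact Or.inr ih
  exact (key (Fin.last N)).symm

/-- The `N + 1` nonnegative poles bound `N` gaps, each holding one zero; the half-line beyond the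
last pole holds one more exactly when `σ ≠ 0` or the drift is positive. -/
theorem exists_positive_solutions {q : ℝ} (hq : 0 < q) :
    ∃ ζ : Fin p.numPos → ℝ, StrictMono ζ ∧ Set.range ζ = {z | 0 < z ∧ z ∈ p.solutions q} := by
  have hs : (0 : ℝ) ≤ p.σ ^ 2 / 2 := by positivity
  have hc := p.poleWeight_pos hq
  have hgap := fun i => existsUnique_pickFun_zero_Ioo (b := p.drift) hs hc p.pole_injective
    (p.pole_inl_lt i) (p.pole_inl_gap i)
  choose f hf hfu using hgap
  have hfmono : StrictMono f := by
    intro i j hij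
    have h1 := (hf i).1.2
    have h2 := (hf j).1.1
    have h3 : p.pole (.inl i.succ) ≤ p.pole (.inl j.castSucc) := by
      simp only [pole, Sum.elim_inl]
      refine p.strictMono_cons_ρ.monotone ?_
      exact Fin.succ_le_castSucc_iff.2 hij
    linarith
  have hfpos : ∀ i, 0 < f i := fun i => (p.pole_inl_nonneg _).trans_lt (hf i).1.1
  have hfsol : ∀ i, 0 < f i ∧ f i ∈ p.solutions q := fun i => by
    refine ⟨hfpos i, (p.mem_solutions_iff (hfpos i).ne').2 ⟨fun k hk => ?_, (hf i).2⟩⟩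
    have := (hf i).1
    rw [hk] at this
    rcases p.pole_inl_gap i k with h | h <;> linarith [this.1, this.2]
  by_cases hcond : p.σ ≠ 0 ∨ 0 < p.drift
  · obtain ⟨z, ⟨hz, hz0⟩, hzu⟩ := existsUnique_pickFun_zero_Ioi (b := p.drift) hs
      (hcond.imp_left fun h => by positivity) hc p.pole_injective p.pole_le_last
    have hzpos : 0 < z := (p.pole_inl_nonneg _).trans_lt hz
    have hM : p.numPos = N + 1 := by simp [numPos, hcond]
    rw [hM]
    have hfz : ∀ i, f i < z := fun i => by
      have h1 := (hf i).1.2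
      have h2 := p.pole_le_last (.inl i.succ)
      have h3 : p.pole (.inl (Fin.last N)) < z := hz
      linarith
    refine ⟨Fin.snoc f z, ?_, ?_⟩
    · intro i j hij
      induction i using Fin.lastCases with
      | last => exact absurd hij (Fin.le_last j).not_gt
      | cast i =>
        induction j using Fin.lastCases with
        | last => simpa using hfz i
        | cast j => simpa using hfmono (Fin.castSucc_lt_castSucc_iff.1 hij)
    · ext y
      rw [Set.mem_range]
      constructor
      · rintro ⟨i, rfl⟩
        induction i using Fin.lastCases with
        | cast i => simpa using hfsol i
        | last =>
          simp only [Fin.snoc_last]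
          refine ⟨hzpos, (p.mem_solutions_iff hzpos.ne').2 ⟨fun k hk => ?_, hz0⟩⟩
          exact absurd (p.pole_le_last k) (not_le.2 (hk ▸ hz))
      · intro hy
        obtain ⟨h1, h2, h3⟩ := p.mem_solutions_pos_iff.1 hy
        rcases p.exists_gap h1 h2 with ⟨i, hi⟩ | h
        · exact ⟨i.castSucc, by simpa using (hfu i y ⟨hi, h3⟩).symm⟩
        · exact ⟨Fin.last N, by simpa using (hzu y ⟨h, h3⟩).symm⟩
  · have hM : p.numPos = N := by simp [numPos, hcond]
    rw [hM]
    push Not at hcond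
    refine ⟨f, hfmono, ?_⟩
    ext y
    rw [Set.mem_range]
    constructor
    · rintro ⟨i, rfl⟩
      exact hfsol i
    · intro hy
      obtain ⟨h1, h2, h3⟩ := p.mem_solutions_pos_iff.1 hy
      rcases p.exists_gap h1 h2 with ⟨i, hi⟩ | h
      · exact ⟨i, (hfu i y ⟨hi, h3⟩).symm⟩
      · exact absurd h3 (pickFun_neg_of_gt (by simp [hcond.1]) hcond.2 hc p.pole_le_last h).ne

/-! ### Negative solutions by reflection -/

/-- The parameters of the process `-X`. -/
def dual : HyperexpParams N' N where
  σ := p.σ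
  drift := -p.drift
  a := p.aHat
  ρ := p.ρHat
  aHat := p.a
  ρHat := p.ρ
  σ_nonneg := p.σ_nonneg
  a_pos := p.aHat_pos
  ρ_pos := p.ρHat_pos
  ρ_strictMono := p.ρHat_strictMono
  aHat_pos := p.a_pos
  ρHat_pos := p.ρ_pos
  ρHat_strictMono := p.ρ_strictMono

theorem psi_dual (z : ℝ) : p.dual.psi z = p.psi (-z) := by
  simp only [psi, dual, sub_eq_add_neg, neg_neg]
  ring

theorem numPos_dual : p.dual.numPos = p.numNeg := by
  simp [numPos, numNeg, dual]

theorem mem_solutions_dual {q z : ℝ} : z ∈ p.dual.solutions q ↔ -z ∈ p.solutions q := by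
  have h : ∀ x, -z = x ↔ z = -x := fun x => neg_eq_iff_eq_neg
  simp only [solutions, Set.mem_ofPred_eq, psi_dual]
  simp only [dual, ne_eq, h, neg_neg]
  tauto

theorem exists_negative_solutions {q : ℝ} (hq : 0 < q) :
    ∃ ζHat : Fin p.numNeg → ℝ,
      StrictMono ζHat ∧ Set.range ζHat = {z | 0 < z ∧ -z ∈ p.solutions q} := by
  rw [← numPos_dual]
  simpa only [mem_solutions_dual] using p.dual.exists_positive_solutions hq

end HyperexpParams

/-! ### Partial fractions -/

open Polynomial in
/-- Partial fraction expansion of `D / P + α`, where `P` has simple zeros `r i`, as many as its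
degree allows, and derivative `w i * D(r i)` at `r i`. The identity is multiplied by `P`. -/
theorem partial_fraction {R : Type*} [Fintype R] {r w : R → ℝ}
    (hr : Function.Injective r) {D P : ℝ[X]} {α : ℝ} (hP : ∀ i, P.eval (r i) = 0)
    (hw : ∀ i, P.derivative.eval (r i) = w i * D.eval (r i)) (hw0 : ∀ i, w i ≠ 0)
    (hPdeg : P.degree ≤ Fintype.card R)
    (hdeg : (D + C α * P).degree < Fintype.card R) {z : ℂ} (hz : ∀ i, z ≠ r i) :
    aeval z D + α * aeval z P = ∑ i, aeval z P / (w i * (z - r i)) := by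
  have hdvd : ∀ i, ∃ F : ℝ[X], P = (X - C (r i)) * F := fun i => dvd_iff_isRoot.2 (hP i)
  choose F hF using hdvd
  have hFself : ∀ i, (F i).eval (r i) = w i * D.eval (r i) := fun i => by
    rw [← hw i]
    conv_rhs => rw [hF i]
    simp
  have hFne : ∀ i j, i ≠ j → (F i).eval (r j) = 0 := fun i j hij => by
    have h := hP j
    rw [hF i, eval_mul] at h
    refine (mul_eq_zero.1 h).resolve_left ?_
    simpa [sub_eq_zero] using fun h => hij (hr h).symm
  -- Lagrange interpolation: both sides have degree below the number of nodes. At `r j` the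
  -- polynomial `P` vanishes and only the term `F j` survives, with value `w j * D(r j)`.
  have key : D + C α * P = ∑ i, C (w i)⁻¹ * F i := by
    refine eq_of_degrees_lt_of_eval_index_eq (v := r) Finset.univ hr.injOn (by simpa using hdeg)
      ?_ fun j _ => ?_
    · refine (degree_sum_le _ _).trans_lt
        ((Finset.sup_lt_iff (WithBot.bot_lt_coe _)).2 fun i _ => ?_)
      · refine lt_of_le_of_lt (b := (F i).degree)
          (by rw [← smul_eq_C_mul]; exact degree_smul_le _ _) ?_
        by_cases h0 : F i = 0
        · rw [h0, degree_zero]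
          exact WithBot.bot_lt_coe _
        · have h1 := hPdeg
          rw [hF i, degree_mul, degree_X_sub_C, degree_eq_natDegree h0] at h1
          rw [degree_eq_natDegree h0]
          simp only [Finset.card_univ]
          norm_cast at h1 ⊢
          omega
    · rw [eval_finsetSum, Finset.sum_eq_single j]
      · simp [hP, hFself, hw0]
      · intro i _ hij
        simp [hFne i j hij]
      · simp
  have h := congrArg (aeval z) key
  simp only [map_add, map_mul, aeval_C, map_sum] at h
  rw [show (α : ℂ) = algebraMap ℝ ℂ α from rfl, h]
  refine Finset.sum_congr rfl fun i _ => ?_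
  have hzi : z - r i ≠ 0 := sub_ne_zero.2 (hz i)
  have hwi : (w i : ℂ) ≠ 0 := by exact_mod_cast hw0 i
  conv_rhs => rw [hF i]
  simp only [map_mul, map_sub, aeval_X, aeval_C, Complex.coe_algebraMap, Complex.ofReal_inv]
  field_simp

open Polynomial in
/-- The partial fraction expansion of `1 / (ψ - q)` for a rational function
`ψ(z) - q = s z² + b z + e - ∑ c_k / (z - x_k)` that has as many zeros as its numerator allows. -/
theorem inv_rational_eq_sum {K R : Type*} [Fintype K] [Fintype R] {s b e α : ℝ} {c x : K → ℝ}
    {r w : R → ℝ} (hr : Function.Injective r) (hrx : ∀ i k, r i ≠ x k)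
    (hroot : ∀ i, s * r i ^ 2 + b * r i + e - ∑ k, c k / (r i - x k) = 0)
    (hderiv : ∀ i,
      HasDerivAt (fun z => s * z ^ 2 + b * z + e - ∑ k, c k / (z - x k)) (w i) (r i))
    (hw0 : ∀ i, w i ≠ 0)
    (hcard : (Fintype.card R = Fintype.card K + 2 ∧ α = 0) ∨
      (s = 0 ∧ Fintype.card R = Fintype.card K + 1 ∧ α = 0) ∨
      (s = 0 ∧ b = 0 ∧ Fintype.card R = Fintype.card K ∧ 1 + α * e = 0))
    {z : ℂ} (hzx : ∀ k, z ≠ x k) (hzr : ∀ i, z ≠ r i) {h : ℂ}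
    (hh : h = s * z ^ 2 + b * z + e - ∑ k, c k / (z - x k)) :
    h⁻¹ = -α + ∑ i, 1 / (w i * (z - r i)) := by
  classical
  -- `D` clears the denominators, and `P` is the resulting numerator.
  set D : ℝ[X] := ∏ k, (X - C (x k)) with hD
  set E : K → ℝ[X] := fun k => ∏ j ∈ Finset.univ.erase k, (X - C (x j)) with hE
  set A : ℝ[X] := C s * X ^ 2 + C b * X + C e with hA
  set P : ℝ[X] := A * D - ∑ k, C (c k) * E k with hPdef
  have hDE : ∀ k, D = (X - C (x k)) * E k := fun k =>
    (Finset.mul_prod_erase _ _ (Finset.mem_univ k)).symm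
  have hDdeg : D.degree = Fintype.card K := by simp [hD, degree_prod]
  have hEdeg : ∀ k, (E k).degree < Fintype.card K := fun k => by
    have : 0 < Fintype.card K := Fintype.card_pos_iff.2 ⟨k⟩
    simp only [hE, degree_prod, degree_X_sub_C, Finset.sum_const, Finset.card_erase_of_mem
      (Finset.mem_univ k), Finset.card_univ, nsmul_eq_mul, mul_one]
    norm_cast
    omega
  have hSdeg : ∀ d : K → ℝ, (∑ k, C (d k) * E k).degree < Fintype.card K := fun d => by
    refine (degree_sum_le _ _).trans_lt ((Finset.sup_lt_iff (WithBot.bot_lt_coe _)).2 fun k _ => ?_)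
    refine lt_of_le_of_lt (b := (E k).degree) ?_ (hEdeg k)
    rw [← smul_eq_C_mul]
    exact degree_smul_le _ _
  have hPdeg_of : ∀ n : ℕ, A.degree ≤ n → P.degree ≤ (Fintype.card K + n : ℕ) := fun n hn => by
    refine (degree_sub_le _ _).trans (max_le ?_ ?_)
    · refine (degree_mul_le _ _).trans ?_
      rw [hDdeg, add_comm]
      push_cast
      gcongr
    · refine (hSdeg c).le.trans ?_
      exact_mod_cast Nat.le_add_right _ _
  have hPeval : ∀ y : ℝ, (∀ k, y ≠ x k) →
      P.eval y = (s * y ^ 2 + b * y + e - ∑ k, c k / (y - x k)) * D.eval y := fun y hy => by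
    rw [sub_mul, Finset.sum_mul]
    simp only [hPdef, hA, eval_sub, eval_mul, eval_add, eval_C, eval_pow, eval_X, eval_finsetSum]
    congr 1
    refine Finset.sum_congr rfl fun k _ => ?_
    have := sub_ne_zero.2 (hy k)
    rw [hDE k]
    simp only [eval_mul, eval_sub, eval_X, eval_C]
    field_simp
  have hPz : aeval z P = h * aeval z D := by
    rw [hh, sub_mul, Finset.sum_mul]
    simp only [hPdef, hA, map_sub, map_mul, map_add, aeval_C, map_pow, aeval_X, map_sum,
      Complex.coe_algebraMap]
    congr 1
    refine Finset.sum_congr rfl fun k _ => ?_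
    have := sub_ne_zero.2 (hzx k)
    rw [hDE k]
    simp only [map_mul, map_sub, aeval_X, aeval_C, Complex.coe_algebraMap]
    field_simp
  have hDz : aeval z D ≠ 0 := by
    simp only [hD, map_prod, map_sub, aeval_X, aeval_C, Complex.coe_algebraMap]
    exact Finset.prod_ne_zero_iff.2 fun k _ => sub_ne_zero.2 (hzx k)
  have hP0 : ∀ i, P.eval (r i) = 0 := fun i => by rw [hPeval _ (hrx i), hroot, zero_mul]
  -- Near a root `P` is the rational function times `D`; the term with `D'` drops out because the
  -- rational function vanishes at the root.
  have hP' : ∀ i, P.derivative.eval (r i) = w i * D.eval (r i) := fun i => by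
    have h1 := (hderiv i).mul (D.hasDerivAt (r i))
    rw [hroot, zero_mul, add_zero] at h1
    refine (P.hasDerivAt (r i)).unique (h1.congr_of_eventuallyEq ?_)
    have : ∀ᶠ y in 𝓝 (r i), ∀ k, y ≠ x k :=
      eventually_all.2 fun k => isOpen_ne.mem_nhds (hrx i k)
    filter_upwards [this] with y hy using hPeval y hy
  -- With `α = 0` only `deg D` has to be compared with the number of zeros. In the last case `D` and
  -- `P` have leading coefficients `1` and `e` in the same degree, and `1 + α e = 0` cancels them.
  have hdegs : P.degree ≤ Fintype.card R ∧ (D + C α * P).degree < Fintype.card R := by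
    have hA2 : A.degree ≤ (2 : ℕ) := degree_quadratic_le
    rcases hcard with ⟨hc, rfl⟩ | ⟨rfl, hc, rfl⟩ | ⟨rfl, rfl, hc, hα⟩
    · rw [hc, C_0, zero_mul, add_zero, hDdeg]
      exact ⟨hPdeg_of 2 hA2, by norm_cast; omega⟩
    · rw [hc, C_0, zero_mul, add_zero, hDdeg]
      refine ⟨hPdeg_of 1 ?_, by norm_cast; omega⟩
      simpa [hA] using degree_linear_le (a := b) (b := e)
    · rw [hc]
      refine ⟨hPdeg_of 0 (by simpa [hA] using degree_C_le), ?_⟩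
      have : D + C α * P = ∑ k, C (-α * c k) * E k := by
        have h2 : ∑ k, C (-α * c k) * E k = -(C α * ∑ k, C (c k) * E k) := by
          rw [Finset.mul_sum, ← Finset.sum_neg_distrib]
          refine Finset.sum_congr rfl fun k _ => ?_
          simp only [C_mul, C_neg]
          ring
        have h3 : (1 : ℝ[X]) + C α * C e = 0 := by rw [← C_mul, ← C_1, ← C_add, hα, C_0]
        rw [h2, hPdef, hA, C_0]
        linear_combination D * h3
      rw [this]
      exact hSdeg _
  have key := partial_fraction hr hP0 hP' hw0 hdegs.1 hdegs.2 hzr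
  rw [hPz] at key
  have h4 : (1 : ℂ) + α * h = h * ∑ i, 1 / (w i * (z - r i)) := by
    refine mul_right_cancel₀ hDz ?_
    rw [Finset.mul_sum, Finset.sum_mul]
    rw [show (1 + α * h) * aeval z D = aeval z D + α * (h * aeval z D) by ring, key]
    exact Finset.sum_congr rfl fun i _ => by ring
  rw [inv_eq_iff_eq_inv, ← one_div, eq_div_iff_mul_eq]
  · linear_combination -h4
  -- If the candidate inverse were `0`, the relation `h4` would read `1 + α h = α h`.
  · intro h5
    have : h * ∑ i, 1 / (w i * (z - r i)) = α * h := by linear_combination h * h5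
    rw [this] at h4
    simp at h4

/-! ### Fourier transforms of two-sided exponential mixtures -/

/-- The two-sided exponential mixture, with weights `w` and rates `u` on the positive half-line, and
with the primed weights and rates on the negative half-line. -/
noncomputable def twoSidedExp {M M' : ℕ} (w u : Fin M → ℝ) (w' u' : Fin M' → ℝ) (x : ℝ) : ℝ :=
  (if 0 < x then ∑ l, w l * Real.exp (-(u l) * x) else 0) +
    (if x < 0 then ∑ l, w' l * Real.exp (u' l * x) else 0)

section TwoSidedExp

variable {M M' : ℕ} {w u : Fin M → ℝ} {w' u' : Fin M' → ℝ}

theorem twoSidedExp_nonneg (hw : ∀ l, 0 ≤ w l) (hw' : ∀ l, 0 ≤ w' l) (x : ℝ) :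
    0 ≤ twoSidedExp w u w' u' x := by
  refine add_nonneg ?_ ?_ <;> split_ifs <;> try exact le_rfl
  · exact Finset.sum_nonneg fun l _ => mul_nonneg (hw l) (Real.exp_pos _).le
  · exact Finset.sum_nonneg fun l _ => mul_nonneg (hw' l) (Real.exp_pos _).le

theorem measurable_twoSidedExp : Measurable (twoSidedExp w u w' u') := by
  refine Measurable.add (Measurable.ite measurableSet_Ioi ?_ measurable_const)
    (Measurable.ite measurableSet_Iio ?_ measurable_const) <;> fun_prop

theorem twoSidedExp_mul_cexp (θ x : ℝ) :
    (twoSidedExp w u w' u' x : ℂ) * Complex.exp (Complex.I * θ * x) =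
      (Set.Ioi (0 : ℝ)).indicator
          (fun x : ℝ => ∑ l, (w l : ℂ) * Complex.exp ((-(u l) + Complex.I * θ) * x)) x +
        (Set.Iio (0 : ℝ)).indicator
          (fun x : ℝ => ∑ l, (w' l : ℂ) * Complex.exp ((u' l + Complex.I * θ) * x)) x := by
  simp only [twoSidedExp, Set.indicator_apply, Set.mem_Ioi, Set.mem_Iio, Complex.ofReal_add,
    add_mul (Complex.ofReal _)]
  congr 1 <;> split_ifs <;> simp [Finset.sum_mul, add_mul, Complex.exp_add, mul_assoc]

theorem integrable_twoSidedExp_pos (hu : ∀ l, 0 < u l) (θ : ℝ) :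
    IntegrableOn
      (fun x : ℝ => ∑ l, (w l : ℂ) * Complex.exp ((-(u l) + Complex.I * θ) * x)) (Set.Ioi 0) :=
  integrable_finsetSum _ fun l _ =>
    (integrableOn_exp_mul_complex_Ioi (by simpa using hu l) 0).const_mul _

theorem integrable_twoSidedExp_neg (hu' : ∀ l, 0 < u' l) (θ : ℝ) :
    IntegrableOn
      (fun x : ℝ => ∑ l, (w' l : ℂ) * Complex.exp ((u' l + Complex.I * θ) * x)) (Set.Iio 0) :=
  integrable_finsetSum _ fun l _ =>
    ((integrableOn_exp_mul_complex_Iic (by simpa using hu' l) 0).mono_set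
      Set.Iio_subset_Iic_self).const_mul _

theorem integrable_twoSidedExp_mul_cexp (hu : ∀ l, 0 < u l) (hu' : ∀ l, 0 < u' l) (θ : ℝ) :
    Integrable fun x : ℝ =>
      (twoSidedExp w u w' u' x : ℂ) * Complex.exp (Complex.I * θ * x) := by
  simp only [twoSidedExp_mul_cexp]
  exact ((integrable_indicator_iff measurableSet_Ioi).2 (integrable_twoSidedExp_pos hu θ)).add
    ((integrable_indicator_iff measurableSet_Iio).2 (integrable_twoSidedExp_neg hu' θ))

theorem integrable_twoSidedExp (hu : ∀ l, 0 < u l) (hu' : ∀ l, 0 < u' l) :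
    Integrable (twoSidedExp w u w' u') := by
  have := (integrable_twoSidedExp_mul_cexp (w := w) (w' := w') hu hu' 0).re
  simpa using this

theorem integral_twoSidedExp_mul_cexp (hu : ∀ l, 0 < u l) (hu' : ∀ l, 0 < u' l) (θ : ℝ) :
    ∫ x : ℝ, (twoSidedExp w u w' u' x : ℂ) * Complex.exp (Complex.I * θ * x) =
      ∑ l, w l / (u l - Complex.I * θ) + ∑ l, w' l / (u' l + Complex.I * θ) := by
  simp only [twoSidedExp_mul_cexp]
  rw [integral_add ((integrable_indicator_iff measurableSet_Ioi).2 (integrable_twoSidedExp_pos hu θ))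
    ((integrable_indicator_iff measurableSet_Iio).2 (integrable_twoSidedExp_neg hu' θ)),
    integral_indicator measurableSet_Ioi, integral_indicator measurableSet_Iio,
    ← integral_Iic_eq_integral_Iio, integral_finsetSum, integral_finsetSum]
  · congr 1 <;> refine Finset.sum_congr rfl fun l _ => ?_
    · rw [integral_const_mul, integral_exp_mul_complex_Ioi (by simpa using hu l)]
      rw [show (u l : ℂ) - Complex.I * θ = -(-(u l) + Complex.I * θ) by ring, div_neg]
      simp [div_eq_mul_inv]
    · rw [integral_const_mul, integral_exp_mul_complex_Iic (by simpa using hu' l)]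
      simp [div_eq_mul_inv]
  · exact fun l _ => (integrableOn_exp_mul_complex_Iic (by simpa using hu' l) 0).const_mul _
  · exact fun l _ => (integrableOn_exp_mul_complex_Ioi (by simpa using hu l) 0).const_mul _

theorem isFiniteMeasure_twoSidedExp (hu : ∀ l, 0 < u l) (hu' : ∀ l, 0 < u' l) :
    IsFiniteMeasure (volume.withDensity fun x => ENNReal.ofReal (twoSidedExp w u w' u' x)) :=
  isFiniteMeasure_withDensity_ofReal (integrable_twoSidedExp hu hu').2

theorem integral_cexp_withDensity_twoSidedExp (hw : ∀ l, 0 ≤ w l) (hw' : ∀ l, 0 ≤ w' l)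
    (hu : ∀ l, 0 < u l) (hu' : ∀ l, 0 < u' l) (θ : ℝ) :
    ∫ x : ℝ, Complex.exp (Complex.I * θ * x)
        ∂(volume.withDensity fun x => ENNReal.ofReal (twoSidedExp w u w' u' x)) =
      ∑ l, w l / (u l - Complex.I * θ) + ∑ l, w' l / (u' l + Complex.I * θ) := by
  rw [integral_withDensity_eq_integral_toReal_smul measurable_twoSidedExp.ennreal_ofReal
    (ae_of_all _ fun _ => ENNReal.ofReal_lt_top), ← integral_twoSidedExp_mul_cexp hu hu']
  simp only [ENNReal.toReal_ofReal (twoSidedExp_nonneg hw hw' _), Complex.real_smul]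

end TwoSidedExp

theorem integrable_cexp_I_mul {μ : Measure ℝ} [IsFiniteMeasure μ] (θ : ℝ) :
    Integrable (fun x : ℝ => Complex.exp (Complex.I * θ * x)) μ := by
  refine Integrable.of_bound (by fun_prop) 1 (ae_of_all _ fun x => ?_)
  rw [show Complex.I * θ * x = ((θ * x : ℝ) : ℂ) * Complex.I by push_cast; ring,
    Complex.norm_exp_ofReal_mul_I]

/-! ### The Lévy–Khintchine exponent in closed form -/

namespace HyperexpParams

variable {N N' : ℕ} (p : HyperexpParams N N')

theorem levyDensity_eq : p.levyDensity =
    twoSidedExp (fun l => p.a l * p.ρ l) p.ρ (fun l => p.aHat l * p.ρHat l) p.ρHat := by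
  ext x
  rw [levyDensity, twoSidedExp, add_comm]

/-- The Lévy–Khintchine exponent at `θ` is the value of `ψ` at `iθ`. -/
theorem levyKhintchine_eq (θ : ℝ) : p.levyKhintchine θ =
    p.σ ^ 2 / 2 * (Complex.I * θ) ^ 2 + p.drift * (Complex.I * θ)
      + (∑ l, (p.a l * p.ρ l) / (p.ρ l - Complex.I * θ)
      + ∑ l, (p.aHat l * p.ρHat l) / (p.ρHat l + Complex.I * θ))
      - (∑ l, p.a l + ∑ l, p.aHat l : ℝ) := by
  have hw : ∀ l, 0 ≤ p.a l * p.ρ l := fun l => (mul_pos (p.a_pos l) (p.ρ_pos l)).le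
  have hw' : ∀ l, 0 ≤ p.aHat l * p.ρHat l := fun l => (mul_pos (p.aHat_pos l) (p.ρHat_pos l)).le
  have key := integral_cexp_withDensity_twoSidedExp hw hw' p.ρ_pos p.ρHat_pos
  have : IsFiniteMeasure p.levyMeasure := by
    rw [levyMeasure, levyDensity_eq]
    exact isFiniteMeasure_twoSidedExp p.ρ_pos p.ρHat_pos
  rw [← levyDensity_eq] at key
  change ∀ θ : ℝ, ∫ x : ℝ, Complex.exp (Complex.I * θ * x) ∂p.levyMeasure = _ at key
  -- The total mass is the transform at `θ = 0`, where each term `a ρ / ρ` reduces to `a`.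
  have h0 : ∫ _x : ℝ, (1 : ℂ) ∂p.levyMeasure = (∑ l, p.a l + ∑ l, p.aHat l : ℝ) := by
    have h := key 0
    simp only [Complex.ofReal_zero, mul_zero, zero_mul, Complex.exp_zero, sub_zero, add_zero] at h
    rw [h]
    push_cast
    congr 1 <;> refine Finset.sum_congr rfl fun l _ => ?_
    · exact mul_div_cancel_right₀ _ (by exact_mod_cast (p.ρ_pos l).ne')
    · exact mul_div_cancel_right₀ _ (by exact_mod_cast (p.ρHat_pos l).ne')
  rw [levyKhintchine, integral_sub (integrable_cexp_I_mul θ) (integrable_const _), key, h0]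
  push_cast
  have hI : Complex.I ^ 2 = -1 := Complex.I_sq
  linear_combination (-(p.σ : ℂ) ^ 2 * θ ^ 2 / 2) * hI

end HyperexpParams

/-! ### A right-continuous process at an independent random time -/

/-- The right end point of the cell with index `k` of the grid of mesh `1 / (n + 1)`. -/
noncomputable def gridTime (n : ℕ) (k : ℕ) : ℝ≥0 := (k + 1 : ℝ≥0) / (n + 1 : ℝ≥0)

/-- The index on the grid of mesh `1 / (n + 1)` of the cell that contains `t`. -/
noncomputable def gridIndex (n : ℕ) (t : ℝ≥0) : ℕ := ⌊t * (n + 1)⌋₊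

theorem measurable_gridIndex (n : ℕ) : Measurable (gridIndex n) :=
  Nat.measurable_floor.comp (measurable_id.mul_const _)

theorem le_gridTime (n : ℕ) (t : ℝ≥0) : t ≤ gridTime n (gridIndex n t) := by
  rw [gridTime, gridIndex, le_div_iff₀ (by positivity)]
  exact (Nat.lt_floor_add_one _).le

theorem gridTime_le (n : ℕ) (t : ℝ≥0) : gridTime n (gridIndex n t) ≤ t + 1 / (n + 1) := by
  rw [gridTime, gridIndex, add_div]
  gcongr
  rw [div_le_iff₀ (by positivity)]
  exact Nat.floor_le (by positivity)

/-- Right end points are used so that the grid times approach `t` from the right, the side on which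
the paths are continuous. -/
theorem tendsto_gridTime (t : ℝ≥0) :
    Tendsto (fun n => gridTime n (gridIndex n t)) atTop (𝓝[≥] t) := by
  refine tendsto_nhdsWithin_iff.2 ⟨?_, Eventually.of_forall fun n => le_gridTime n t⟩
  refine tendsto_of_tendsto_of_tendsto_of_le_of_le tendsto_const_nhds ?_
    (fun n => le_gridTime n t) (fun n => gridTime_le n t)
  have : Tendsto (fun n : ℕ => 1 / ((n : ℝ≥0) + 1)) atTop (𝓝 0) :=
    tendsto_one_div_add_atTop_nhds_zero_nat
  simpa using this.const_add t

section RandomTime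

variable {Ω : Type*} [MeasurableSpace Ω] {P : Measure Ω}
  {X : ℝ≥0 → Ω → ℝ} {e : Ω → ℝ≥0}

theorem ae_tendsto_gridTime
    (hcont : ∀ᵐ ω ∂P, ∀ t : ℝ≥0, ContinuousWithinAt (fun s => X s ω) (Set.Ici t) t) :
    ∀ᵐ ω ∂P, Tendsto (fun n => X (gridTime n (gridIndex n (e ω))) ω) atTop (𝓝 (X (e ω) ω)) := by
  filter_upwards [hcont] with ω hω using (hω (e ω)).tendsto.comp (tendsto_gridTime (e ω))

/-- On a countable set of times, joint measurability in time and path reduces to that of each single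
evaluation. -/
theorem measurable_gridTime_eval (n : ℕ) :
    Measurable fun y : ℕ × (ℝ≥0 → ℝ) => y.2 (gridTime n y.1) :=
  measurable_from_prod_countable_right fun k => measurable_pi_apply (gridTime n k)

theorem measurable_process_gridTime (hX : ∀ t, Measurable (X t)) (he : Measurable e) (n : ℕ) :
    Measurable fun ω => X (gridTime n (gridIndex n (e ω))) ω :=
  (measurable_gridTime_eval n).comp
    (((measurable_gridIndex n).comp he).prodMk (measurable_pi_lambda (fun ω t => X t ω) hX))

theorem aemeasurable_process_randomTime (hX : ∀ t, Measurable (X t)) (he : Measurable e)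
    (hcont : ∀ᵐ ω ∂P, ∀ t : ℝ≥0, ContinuousWithinAt (fun s => X s ω) (Set.Ici t) t) :
    AEMeasurable (fun ω => X (e ω) ω) P :=
  aemeasurable_of_tendsto_metrizable_ae atTop
    (fun n => (measurable_process_gridTime hX he n).aemeasurable) (ae_tendsto_gridTime hcont)

/-- The cell index is independent of the whole path, so Fubini's theorem on the product of their
laws integrates out the path at a fixed grid time. -/
theorem integral_cexp_process_gridTime [IsProbabilityMeasure P] (hX : ∀ t, Measurable (X t))
    (he : Measurable e)
    (hind : IndepFun e (fun ω t => X t ω) P) (θ : ℝ) (n : ℕ) :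
    ∫ ω, Complex.exp (θ * X (gridTime n (gridIndex n (e ω))) ω * Complex.I) ∂P =
      ∫ ω, charFun (P.map (X (gridTime n (gridIndex n (e ω))))) θ ∂P := by
  have hXm : Measurable (fun ω t => X t ω) := measurable_pi_lambda _ hX
  have hk : Measurable fun ω => gridIndex n (e ω) := (measurable_gridIndex n).comp he
  have hind' : IndepFun (fun ω => gridIndex n (e ω)) (fun ω t => X t ω) P :=
    hind.comp (measurable_gridIndex n) measurable_id
  have hmap := (indepFun_iff_map_prod_eq_prod_map_map hk.aemeasurable hXm.aemeasurable).1 hind'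
  have : IsProbabilityMeasure (P.map fun ω => gridIndex n (e ω)) :=
    Measure.isProbabilityMeasure_map hk.aemeasurable
  have : IsProbabilityMeasure (P.map fun ω t => X t ω) :=
    Measure.isProbabilityMeasure_map hXm.aemeasurable
  set F : ℕ × (ℝ≥0 → ℝ) → ℂ := fun y => Complex.exp (θ * y.2 (gridTime n y.1) * Complex.I) with hF
  have hFm : Measurable F := by
    have := measurable_gridTime_eval n
    fun_prop
  have hFi : Integrable F
      ((P.map fun ω => gridIndex n (e ω)).prod (P.map fun ω t => X t ω)) := by
    refine Integrable.of_bound hFm.aestronglyMeasurable 1 (ae_of_all _ fun y => ?_)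
    simp only [hF, ← Complex.ofReal_mul, Complex.norm_exp_ofReal_mul_I, le_refl]
  calc ∫ ω, Complex.exp (θ * X (gridTime n (gridIndex n (e ω))) ω * Complex.I) ∂P
      = ∫ y, F y ∂(P.map fun ω => (gridIndex n (e ω), fun t => X t ω)) :=
        (integral_map (hk.prodMk hXm).aemeasurable hFm.aestronglyMeasurable).symm
    _ = ∫ k, ∫ x, F (k, x) ∂(P.map fun ω t => X t ω) ∂(P.map fun ω => gridIndex n (e ω)) := by
        rw [hmap, integral_prod F hFi]
    _ = ∫ k, charFun (P.map (X (gridTime n k))) θ ∂(P.map fun ω => gridIndex n (e ω)) := by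
        congr 1 with k
        have hFk : Measurable fun x => F (k, x) := hFm.comp measurable_prodMk_left
        rw [charFun_apply_real, integral_map hXm.aemeasurable hFk.aestronglyMeasurable,
          integral_map (hX _).aemeasurable (by fun_prop)]
    _ = ∫ ω, charFun (P.map (X (gridTime n (gridIndex n (e ω))))) θ ∂P :=
        integral_map hk.aemeasurable (Measurable.of_discrete).aestronglyMeasurable

/-- The characteristic function of a right-continuous process, whose one-dimensional laws have the
characteristic functions `exp (t Ψ)`, at an independent random time. -/
theorem charFun_map_process_randomTime [IsProbabilityMeasure P] (hX : ∀ t, Measurable (X t))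
    (he : Measurable e)
    (hcont : ∀ᵐ ω ∂P, ∀ t : ℝ≥0, ContinuousWithinAt (fun s => X s ω) (Set.Ici t) t)
    (hind : IndepFun e (fun ω t => X t ω) P) {θ : ℝ} {Ψ : ℂ} (hΨ : Ψ.re ≤ 0)
    (hchar : ∀ t : ℝ≥0, charFun (P.map (X t)) θ = Complex.exp ((t : ℝ) * Ψ)) :
    charFun (P.map fun ω => X (e ω) ω) θ = ∫ ω, Complex.exp ((e ω : ℝ) * Ψ) ∂P := by
  rw [charFun_apply_real,
    integral_map (aemeasurable_process_randomTime hX he hcont) (by fun_prop)]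
  have h1 : Tendsto (fun n =>
      ∫ ω, Complex.exp (θ * X (gridTime n (gridIndex n (e ω))) ω * Complex.I) ∂P) atTop
      (𝓝 (∫ ω, Complex.exp (θ * X (e ω) ω * Complex.I) ∂P)) := by
    refine tendsto_integral_of_dominated_convergence (fun _ => 1) (fun n => ?_)
      (integrable_const _) (fun n => ae_of_all _ fun ω => ?_) ?_
    · have hc : Continuous fun x : ℝ => Complex.exp (θ * x * Complex.I) := by fun_prop
      exact (hc.measurable.comp (measurable_process_gridTime hX he n)).aestronglyMeasurable
    · simp only [← Complex.ofReal_mul, Complex.norm_exp_ofReal_mul_I, le_refl]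
    · filter_upwards [ae_tendsto_gridTime (e := e) hcont] with ω hω
      have hc : Continuous fun x : ℝ => Complex.exp (θ * x * Complex.I) := by fun_prop
      exact (hc.tendsto _).comp hω
  -- Domination by `1` is where `Re Ψ ≤ 0` enters.
  have h2 : Tendsto (fun n =>
      ∫ ω, Complex.exp ((gridTime n (gridIndex n (e ω)) : ℝ) * Ψ) ∂P) atTop
      (𝓝 (∫ ω, Complex.exp ((e ω : ℝ) * Ψ) ∂P)) := by
    have hc : Continuous fun t : ℝ≥0 => Complex.exp ((t : ℝ) * Ψ) := by fun_prop
    refine tendsto_integral_of_dominated_convergence (fun _ => 1) (fun n => ?_)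
      (integrable_const _) (fun n => ae_of_all _ fun ω => ?_) (ae_of_all _ fun ω => ?_)
    · exact (hc.measurable.comp ((Measurable.of_discrete (f := gridTime n)).comp
        ((measurable_gridIndex n).comp he))).aestronglyMeasurable
    · rw [Complex.norm_exp, Real.exp_le_one_iff, Complex.re_ofReal_mul]
      exact mul_nonpos_of_nonneg_of_nonpos (NNReal.coe_nonneg _) hΨ
    · exact (hc.tendsto _).comp ((tendsto_gridTime (e ω)).mono_right nhdsWithin_le_nhds)
  refine tendsto_nhds_unique h1 (h2.congr fun n => ?_)
  rw [integral_cexp_process_gridTime hX he hind]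
  simp only [hchar]

end RandomTime

/-! ### Killing at an exponential time -/

theorem integral_cexp_expMeasure {q : ℝ} (hq : 0 < q) {Ψ : ℂ} (hΨ : Ψ.re ≤ 0) :
    ∫ t : ℝ, Complex.exp (t * Ψ) ∂(expMeasure q) = q * (q - Ψ)⁻¹ := by
  have hd : expMeasure q = volume.withDensity
      (fun x => ENNReal.ofReal (if 0 ≤ x then q * Real.exp (-(q * x)) else 0)) := by
    rw [expMeasure, gammaMeasure]
    congr 1 with x
    exact exponentialPDF_eq q x
  have hm : Measurable fun x : ℝ => if 0 ≤ x then q * Real.exp (-(q * x)) else 0 :=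
    Measurable.ite measurableSet_Ici (by fun_prop) measurable_const
  rw [hd, integral_withDensity_eq_integral_toReal_smul hm.ennreal_ofReal
    (ae_of_all _ fun _ => ENNReal.ofReal_lt_top)]
  have h : ∀ x : ℝ,
      (ENNReal.ofReal (if 0 ≤ x then q * Real.exp (-(q * x)) else 0)).toReal •
        Complex.exp (x * Ψ) =
      (Set.Ici (0 : ℝ)).indicator (fun x : ℝ => (q : ℂ) * Complex.exp ((Ψ - q) * x)) x := by
    intro x
    rw [ENNReal.toReal_ofReal (by positivity)]
    simp only [Set.indicator_apply, Set.mem_Ici]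
    split_ifs
    · rw [Complex.real_smul]
      push_cast
      rw [mul_assoc, ← Complex.exp_add]
      ring_nf
    · simp
  simp only [h]
  rw [integral_indicator measurableSet_Ici, integral_Ici_eq_integral_Ioi, integral_const_mul,
    integral_exp_mul_complex_Ioi (by simp; linarith)]
  rw [show Ψ - q = -(q - Ψ) by ring, div_neg]
  simp [neg_div]

theorem charFun_hyperexponential_expTime {Ω : Type*} [MeasurableSpace Ω] {P : Measure Ω}
    [IsProbabilityMeasure P] {N N' : ℕ} {p : HyperexpParams N N'} {X : ℝ≥0 → Ω → ℝ}
    (hX : IsHyperexponential P X p) {q : ℝ} (hq : 0 < q) {e : Ω → ℝ≥0} (he : Measurable e)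
    (he_law : HasLaw (fun ω => (e ω : ℝ)) (expMeasure q) P)
    (he_indep : IndepFun e (fun ω t => X t ω) P) (θ : ℝ) :
    (p.levyKhintchine θ).re ≤ 0 ∧
      charFun (P.map fun ω => X (e ω) ω) θ = q * (q - p.levyKhintchine θ)⁻¹ := by
  -- A characteristic function is bounded by `1`, and at time `1` its modulus is `e^{Re Ψ}`.
  have hΨ : (p.levyKhintchine θ).re ≤ 0 := by
    have : IsProbabilityMeasure (P.map (X 1)) :=
      Measure.isProbabilityMeasure_map (hX.measurable 1).aemeasurable
    have h := norm_charFun_le_one (μ := P.map (X 1)) θ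
    rw [hX.charFun_eq, Complex.norm_exp, Real.exp_le_one_iff] at h
    simpa using h
  refine ⟨hΨ, ?_⟩
  rw [charFun_map_process_randomTime hX.measurable he
    (hX.cadlag.mono fun ω h t => (h t).1) he_indep hΨ fun t => hX.charFun_eq t θ,
    ← integral_cexp_expMeasure hq hΨ, ← he_law.map_eq,
    integral_map he_law.aemeasurable (by fun_prop)]

theorem I_mul_ofReal_ne_ofReal {θ x : ℝ} (hx : x ≠ 0) : Complex.I * θ ≠ (x : ℂ) := fun h =>
  hx (by simpa using (congrArg Complex.re h).symm)

/-! ### The expansion of 1 / (ψ - q) on the imaginary axis -/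

namespace HyperexpParams

variable {N N' : ℕ} (p : HyperexpParams N N')

/-- The poles of `ψ`. -/
noncomputable def psiPole : Fin N ⊕ Fin N' → ℝ := Sum.elim p.ρ fun l => -p.ρHat l

/-- The residues of `-ψ` at its poles. -/
noncomputable def psiResidue : Fin N ⊕ Fin N' → ℝ :=
  Sum.elim (fun l => p.a l * p.ρ l) fun l => -(p.aHat l * p.ρHat l)

theorem psiPole_ne_zero (k) : p.psiPole k ≠ 0 := by
  rcases k with l | l
  · exact (p.ρ_pos l).ne'
  · exact neg_ne_zero.2 (p.ρHat_pos l).ne'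

/-- Writes `z a / (ρ - z)` as `-a - a ρ / (z - ρ)`, and likewise for the negative jumps; the
constants collect into `-1/γ`. The residues now have mixed signs, which partial fractions tolerate.
-/
theorem psi_sub_eq (q : ℝ) {z : ℝ} (hz : ∀ k, z ≠ p.psiPole k) :
    p.psi z - q = p.σ ^ 2 / 2 * z ^ 2 + p.drift * z + -(q + ∑ l, p.a l + ∑ l, p.aHat l) -
      ∑ k, p.psiResidue k / (z - p.psiPole k) := by
  have h1 : z * ∑ l, p.a l / (p.ρ l - z) =
      -∑ l, p.a l - ∑ l, p.a l * p.ρ l / (z - p.ρ l) := by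
    rw [Finset.mul_sum, ← Finset.sum_neg_distrib, ← Finset.sum_sub_distrib]
    refine Finset.sum_congr rfl fun l _ => ?_
    have h : z - p.ρ l ≠ 0 := sub_ne_zero.2 (hz (.inl l))
    have h' : p.ρ l - z ≠ 0 := sub_ne_zero.2 (hz (.inl l)).symm
    field_simp
    ring
  have h2 : z * ∑ l, p.aHat l / (p.ρHat l + z) =
      ∑ l, p.aHat l + ∑ l, -(p.aHat l * p.ρHat l) / (z - -p.ρHat l) := by
    rw [Finset.mul_sum, ← Finset.sum_add_distrib]
    refine Finset.sum_congr rfl fun l _ => ?_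
    have h : z - -p.ρHat l ≠ 0 := sub_ne_zero.2 (hz (.inr l))
    have h' : p.ρHat l + z ≠ 0 := by rwa [sub_neg_eq_add, add_comm] at h
    rw [sub_neg_eq_add, add_comm z]
    field_simp
    ring
  simp only [psi, h1, h2, Fintype.sum_sum_type, psiPole, psiResidue, Sum.elim_inl, Sum.elim_inr]
  ring

theorem levyKhintchine_sub_eq (q θ : ℝ) :
    p.levyKhintchine θ - q = (p.σ ^ 2 / 2 : ℝ) * (Complex.I * θ) ^ 2 + p.drift * (Complex.I * θ) +
      (-(q + ∑ l, p.a l + ∑ l, p.aHat l) : ℝ) -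
      ∑ k, (p.psiResidue k : ℂ) / (Complex.I * θ - p.psiPole k) := by
  have h1 : ∑ l, (p.a l * p.ρ l : ℂ) / (p.ρ l - Complex.I * θ) =
      -∑ l, (p.a l * p.ρ l : ℂ) / (Complex.I * θ - p.ρ l) := by
    rw [← Finset.sum_neg_distrib]
    refine Finset.sum_congr rfl fun l _ => ?_
    rw [← div_neg, neg_sub]
  have h2 : ∑ l, (p.aHat l * p.ρHat l : ℂ) / (p.ρHat l + Complex.I * θ) =
      -∑ l, (-(p.aHat l * p.ρHat l) : ℂ) / (Complex.I * θ - -p.ρHat l) := by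
    rw [← Finset.sum_neg_distrib]
    refine Finset.sum_congr rfl fun l _ => ?_
    rw [neg_div, neg_neg, sub_neg_eq_add, add_comm]
  rw [levyKhintchine_eq, h1, h2]
  simp only [Fintype.sum_sum_type, psiPole, psiResidue, Sum.elim_inl, Sum.elim_inr]
  push_cast
  ring

theorem not_pole_of_mem_solutions {q z : ℝ} (h : z ∈ p.solutions q) (k) : z ≠ p.psiPole k := by
  rcases k with l | l
  · exact h.1 l
  · exact h.2.1 l

theorem alpha_nonneg {q : ℝ} (hq : 0 < q) : 0 ≤ p.alpha q := by
  have h1 := Finset.sum_nonneg fun l (_ : l ∈ Finset.univ) => (p.a_pos l).le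
  have h2 := Finset.sum_nonneg fun l (_ : l ∈ Finset.univ) => (p.aHat_pos l).le
  rw [alpha, gam]
  split_ifs <;> positivity

/-- A Gaussian part adds a solution on each side, a drift without Gaussian part adds one on the side
of its sign. These are the degree cases required by `inv_rational_eq_sum`. -/
theorem card_solutions_cases {q : ℝ} (hq : 0 < q) :
    (p.numPos + p.numNeg = N + N' + 2 ∧ p.alpha q = 0) ∨
      (p.σ ^ 2 / 2 = 0 ∧ p.numPos + p.numNeg = N + N' + 1 ∧ p.alpha q = 0) ∨
      (p.σ ^ 2 / 2 = 0 ∧ p.drift = 0 ∧ p.numPos + p.numNeg = N + N' ∧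
        1 + p.alpha q * -(q + ∑ l, p.a l + ∑ l, p.aHat l) = 0) := by
  by_cases hσ : p.σ = 0
  · right
    rcases lt_trichotomy p.drift 0 with hd | hd | hd
    · left
      simp [numPos, numNeg, alpha, hσ, hd, hd.ne, hd.not_gt, add_assoc]
    · right
      have h1 := Finset.sum_nonneg fun l (_ : l ∈ Finset.univ) => (p.a_pos l).le
      have h2 := Finset.sum_nonneg fun l (_ : l ∈ Finset.univ) => (p.aHat_pos l).le
      have h3 : q + ∑ l, p.a l + ∑ l, p.aHat l ≠ 0 := by positivity
      refine ⟨by simp [hσ], hd, by simp [numPos, numNeg, hσ, hd], ?_⟩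
      rw [alpha, if_pos ⟨by simp [hσ], hd⟩, gam, mul_neg, one_div_mul_cancel h3, add_neg_cancel]
    · left
      simp [numPos, numNeg, alpha, hσ, hd, hd.ne', hd.not_gt, add_right_comm]
  · left
    refine ⟨?_, by simp [alpha, hσ]⟩
    simp only [numPos, numNeg, ne_eq, hσ, not_false_eq_true, true_or, if_true]
    omega

/-- The partial fraction expansion of `1 / (ψ - q)` on the imaginary axis. -/
theorem inv_levyKhintchine_sub {q : ℝ} (hq : 0 < q) {ζ : Fin p.numPos → ℝ}
    {ζHat : Fin p.numNeg → ℝ} (hζ : Function.Injective ζ) (hζHat : Function.Injective ζHat)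
    (hsol : ∀ l, 0 < ζ l ∧ ζ l ∈ p.solutions q)
    (hsolHat : ∀ l, 0 < ζHat l ∧ -ζHat l ∈ p.solutions q) (θ : ℝ) :
    (p.levyKhintchine θ - q)⁻¹ = -p.alpha q +
      (∑ l, 1 / (deriv p.psi (ζ l) * (Complex.I * θ - ζ l)) +
        ∑ l, 1 / (deriv p.psi (-ζHat l) * (Complex.I * θ + ζHat l))) := by
  set r : Fin p.numPos ⊕ Fin p.numNeg → ℝ := Sum.elim ζ fun l => -ζHat l with hr
  have hinj : Function.Injective r :=
    Function.Injective.sumElim hζ (neg_injective.comp hζHat) fun i j h => by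
      linarith [(hsol i).1, (hsolHat j).1]
  have hrsol : ∀ i, r i ≠ 0 ∧ r i ∈ p.solutions q := by
    rintro (l | l)
    · exact ⟨(hsol l).1.ne', (hsol l).2⟩
    · exact ⟨neg_ne_zero.2 (hsolHat l).1.ne', (hsolHat l).2⟩
  have key := inv_rational_eq_sum (K := Fin N ⊕ Fin N') (α := p.alpha q)
    (w := fun i => deriv p.psi (r i)) hinj
    (fun i k => p.not_pole_of_mem_solutions (hrsol i).2 k)
    (fun i => by
      rw [← p.psi_sub_eq q (p.not_pole_of_mem_solutions (hrsol i).2), (hrsol i).2.2.2, sub_self])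
    (fun i => by
      obtain ⟨d, -, hd⟩ := p.exists_hasDerivAt_psi hq (hrsol i).1 (hrsol i).2
      rw [hd.deriv]
      refine (hd.sub_const q).congr_of_eventuallyEq ?_
      have : ∀ᶠ y in 𝓝 (r i), ∀ k, y ≠ p.psiPole k :=
        eventually_all.2 fun k => isOpen_ne.mem_nhds (p.not_pole_of_mem_solutions (hrsol i).2 k)
      filter_upwards [this] with y hy using (p.psi_sub_eq q hy).symm)
    (fun i => by
      obtain ⟨d, hd0, hd⟩ := p.exists_hasDerivAt_psi hq (hrsol i).1 (hrsol i).2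
      rw [hd.deriv]
      exact mul_ne_zero (hrsol i).1 hd0.ne')
    (by simpa using p.card_solutions_cases hq)
    (fun k => I_mul_ofReal_ne_ofReal (p.psiPole_ne_zero k))
    (fun i => I_mul_ofReal_ne_ofReal (hrsol i).1) (p.levyKhintchine_sub_eq q θ)
  rw [key, Fintype.sum_sum_type]
  simp [hr]

/-- The minus sign is absorbed into the weights of the negative half-line, which are positive at the
solutions because `ψ'` is negative there. -/
theorem killedDensity_eq {M M' : ℕ} (q : ℝ) (ζ : Fin M → ℝ) (ζHat : Fin M' → ℝ) :
    p.killedDensity q ζ ζHat =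
      twoSidedExp (fun l => q / deriv p.psi (ζ l)) ζ
        (fun l => -(q / deriv p.psi (-ζHat l))) ζHat := by
  ext x
  rw [killedDensity, twoSidedExp, mul_sub, sub_eq_add_neg]
  congr 1
  · split_ifs
    · rw [Finset.mul_sum]
      exact Finset.sum_congr rfl fun l _ => by ring
    · simp
  · split_ifs
    · rw [Finset.mul_sum, ← Finset.sum_neg_distrib]
      exact Finset.sum_congr rfl fun l _ => by ring
    · simp

end HyperexpParams

/-! ### The law at the exponential time -/

theorem theorem3p1 {Ω : Type*} [MeasurableSpace Ω] (P : Measure Ω) [IsProbabilityMeasure P]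
    {N N' : ℕ} (p : HyperexpParams N N') (X : ℝ≥0 → Ω → ℝ) (hX : IsHyperexponential P X p)
    (q : ℝ) (hq : 0 < q) (e : Ω → ℝ≥0) (he : Measurable e)
    (he_law : HasLaw (fun ω => (e ω : ℝ)) (expMeasure q) P)
    (he_indep : IndepFun e (fun ω t => X t ω) P) :
    ∃ (ζ : Fin p.numPos → ℝ) (ζHat : Fin p.numNeg → ℝ),
      StrictMono ζ ∧ Set.range ζ = {z | 0 < z ∧ z ∈ p.solutions q} ∧
      StrictMono ζHat ∧ Set.range ζHat = {z | 0 < z ∧ -z ∈ p.solutions q} ∧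
      (∀ l, 0 < deriv p.psi (ζ l)) ∧ (∀ l, deriv p.psi (-(ζHat l)) < 0) ∧
      HasLaw (fun ω => X (e ω) ω)
        (ENNReal.ofReal (q * p.alpha q) • Measure.dirac 0 +
          volume.withDensity (fun x => ENNReal.ofReal (p.killedDensity q ζ ζHat x))) P := by
  obtain ⟨ζ, hζ, hζr⟩ := p.exists_positive_solutions hq
  obtain ⟨ζHat, hζHat, hζHatr⟩ := p.exists_negative_solutions hq
  have hsol : ∀ l, 0 < ζ l ∧ ζ l ∈ p.solutions q := fun l => by
    have : ζ l ∈ Set.range ζ := ⟨l, rfl⟩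
    rwa [hζr] at this
  have hsolHat : ∀ l, 0 < ζHat l ∧ -ζHat l ∈ p.solutions q := fun l => by
    have : ζHat l ∈ Set.range ζHat := ⟨l, rfl⟩
    rwa [hζHatr] at this
  have hd : ∀ l, 0 < deriv p.psi (ζ l) := fun l => by
    obtain ⟨d, hd0, hd⟩ := p.exists_hasDerivAt_psi hq (hsol l).1.ne' (hsol l).2
    rw [hd.deriv]
    exact mul_pos (hsol l).1 hd0
  have hdHat : ∀ l, deriv p.psi (-ζHat l) < 0 := fun l => by
    obtain ⟨d, hd0, hd⟩ :=
      p.exists_hasDerivAt_psi hq (neg_ne_zero.2 (hsolHat l).1.ne') (hsolHat l).2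
    rw [hd.deriv]
    exact mul_neg_of_neg_of_pos (neg_lt_zero.2 (hsolHat l).1) hd0
  refine ⟨ζ, ζHat, hζ, hζr, hζHat, hζHatr, hd, hdHat, ?_, ?_⟩
  · exact aemeasurable_process_randomTime hX.measurable he (hX.cadlag.mono fun ω h t => (h t).1)
  have hu := fun l => (hsol l).1
  have hu' := fun l => (hsolHat l).1
  have hw : ∀ l, 0 ≤ q / deriv p.psi (ζ l) := fun l => (div_pos hq (hd l)).le
  have hw' : ∀ l, 0 ≤ -(q / deriv p.psi (-ζHat l)) := fun l =>
    neg_nonneg.2 (div_neg_of_pos_of_neg hq (hdHat l)).le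
  rw [p.killedDensity_eq]
  have := isFiniteMeasure_twoSidedExp (w := fun l => q / deriv p.psi (ζ l))
    (w' := fun l => -(q / deriv p.psi (-ζHat l))) hu hu'
  have hfin : IsFiniteMeasure (ENNReal.ofReal (q * p.alpha q) • Measure.dirac (0 : ℝ)) :=
    Measure.smul_finite _ ENNReal.ofReal_ne_top
  -- Finite measures are determined by their characteristic functions, so the candidate need not be
  -- shown beforehand to have mass one.
  refine Measure.ext_of_charFun (funext fun θ => ?_)
  rw [(charFun_hyperexponential_expTime hX hq he he_law he_indep θ).2, charFun_apply_real]
  have hcomm : ∀ x : ℝ, (θ : ℂ) * x * Complex.I = Complex.I * θ * x := fun x => by ring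
  simp only [hcomm]
  rw [integral_add_measure (integrable_cexp_I_mul θ) (integrable_cexp_I_mul θ),
    integral_cexp_withDensity_twoSidedExp hw hw' hu hu', integral_smul_measure, integral_dirac,
    ENNReal.toReal_ofReal (mul_nonneg hq.le (p.alpha_nonneg hq)), ← neg_sub, inv_neg,
    p.inv_levyKhintchine_sub hq hζ.injective hζHat.injective hsol hsolHat]
  have h1 : ∑ l, ((q / deriv p.psi (ζ l) : ℝ) : ℂ) / (ζ l - Complex.I * θ) =
      -(q * ∑ l, 1 / (deriv p.psi (ζ l) * (Complex.I * θ - ζ l))) := by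
    rw [Finset.mul_sum, ← Finset.sum_neg_distrib]
    refine Finset.sum_congr rfl fun l _ => ?_
    rw [← neg_sub (Complex.I * θ), div_neg]
    push_cast
    rw [div_div, mul_one_div]
  have h2 : ∑ l, ((-(q / deriv p.psi (-ζHat l)) : ℝ) : ℂ) / (ζHat l + Complex.I * θ) =
      -(q * ∑ l, 1 / (deriv p.psi (-ζHat l) * (Complex.I * θ + ζHat l))) := by
    rw [Finset.mul_sum, ← Finset.sum_neg_distrib]
    refine Finset.sum_congr rfl fun l _ => ?_
    rw [add_comm (ζHat l : ℂ)]
    push_cast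
    rw [neg_div, div_div, mul_one_div]
  rw [h1, h2]
  simp only [mul_zero, Complex.ofReal_zero, Complex.exp_zero, Complex.real_smul, mul_one,
    Complex.ofReal_mul]
  ring
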